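/- Let $\kappa$ be a commutative ring with a ring homomorphism $\kappa\to\mathbb Z_2$, written $a\mapsto a \bmod 2$ (in particular $\kappa=\mathbb Z$ with reduction modulo $2$, or $\kappa=\mathbb Z_2$ with the identity), and write $\equiv$ for equality modulo $2$ in this sense. Let $g,f\in\kappa[[t]]$ with $f(0)=0$ and $f'(0)=1$, and let $\bar f$ be the compositional inverse of $f$. For $m\ge 0$ let $\mathcal B(g,f)_m$ be the $m\times m$ $(0,1)$-matrix whose $(i,j)$ entry, $0\le i,j\le m-1$, is $[t^i]\,g f^j \bmod 2$. For $n\ge 1$ the Riordan graph $G=G_n(g,f)$ is the simple graph on the vertices $1,\dots,n$ with adjacency matrix $B+B^T$, where $B=\mathcal B(tg,f)_n$; it is called proper if $\mathcal B(g,f)_{n-1}$ is invertible over $\mathbb Z_2$. For $0\le j\le n-1$ put $$\phi_j\equiv[t^j]\,\frac{t g}{1-f},\qquad \varphi_j\equiv[t^j]\,\frac{t\,g(\bar f)\,\bar f'\,(t/\bar f)^{n-1}}{1-\bar f}.$$ 1. For every vertex $i\in\{1,\dots,n\}$, the degree $d(i)$ is odd (respectively, even) if and only if $\phi_{i-1}+\varphi_{n-i}\equiv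 1$ (respectively, $0$). 2. Suppose that $G$ is proper. Then $G$ has an Eulerian trail (open or closed) if and only if either $\phi_{i-1}+\varphi_{n-i}\equiv 0$ for all $i=1,\dots,n$, or there are $i_1\ne i_2$ in $\{1,\dots,n\}$ such that $\phi_{i-1}+\varphi_{n-i}\equiv 1$ for $i\in\{i_1,i_2\}$ and $\phi_{i-1}+\varphi_{n-i}\equiv 0$ for all other $i$. In particular, if $\phi_{i-1}+\varphi_{n-i}\equiv 0$ for all $i=1,\dots,n$, then $G$ is Eulerian, i.e. it has a closed Eulerian trail (the trivial one if $n=1$). -/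

import Mathlib

open PowerSeries

namespace RiordanGraph

/-- The leading principal submatrix of order `m` of the binary Riordan matrix of `(g, f)`:
the entry in row `i`, column `j` (both counted from `0`) is `[t^i] g f^j` reduced modulo 2.
The coefficients live in a ring `κ` (such as `ℤ` or `ZMod 2`) and `π` is the reduction modulo 2. -/
noncomputable def binaryRiordan {κ : Type*} [CommRing κ] (π : κ →+* ZMod 2) (g f : κ⟦X⟧) (m : ℕ) :
    Matrix (Fin m) (Fin m) (ZMod 2) :=
  Matrix.of fun i j => π (coeff (i : ℕ) (g * f ^ (j : ℕ)))

/-- The labelled Riordan graph `G_n(g, f)`: its adjacency matrix is the `(0,1)`-matrix `B + Bᵀ`, where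
`B` is the binary Riordan matrix of `(t g, f)` of order `n`. The vertex `i ∈ {1, …, n}` is the
element of `Fin n` with value `i - 1`. (If `f(0) = 0`, then `B` is strictly lower triangular, so
that the sum modulo 2 agrees with the sum of the `(0,1)`-matrices.) -/
noncomputable def graph {κ : Type*} [CommRing κ] (π : κ →+* ZMod 2) (n : ℕ) (g f : κ⟦X⟧) :
    SimpleGraph (Fin n) where
  Adj i j := (binaryRiordan π (X * g) f n + (binaryRiordan π (X * g) f n).transpose) i j = 1
  symm := ⟨fun i j h => by
    rw [Matrix.add_apply, Matrix.transpose_apply] at h ⊢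
    rw [add_comm]; exact h⟩
  loopless := ⟨fun i h => by
    rw [Matrix.add_apply, Matrix.transpose_apply, CharTwo.add_self_eq_zero] at h
    exact zero_ne_one h⟩

noncomputable instance {κ : Type*} [CommRing κ] (π : κ →+* ZMod 2) (n : ℕ) (g f : κ⟦X⟧) :
    DecidableRel (graph π n g f).Adj :=
  fun i j => inferInstanceAs (Decidable
    ((binaryRiordan π (X * g) f n + (binaryRiordan π (X * g) f n).transpose) i j = 1))

/-- `G_n(g, f)` is proper: the binary Riordan matrix of `(g, f)` of order `n - 1` is invertible. -/
def IsProper {κ : Type*} [CommRing κ] (π : κ →+* ZMod 2) (n : ℕ) (g f : κ⟦X⟧) : Prop :=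
  IsUnit (binaryRiordan π g f (n - 1))

/-- The compositional inverse of a power series `f` with `f'(0) = 1` (and `f(0) = 0`). -/
noncomputable def compInv {κ : Type*} [CommRing κ] (f : κ⟦X⟧) (hf : coeff 1 f = 1) : κ⟦X⟧ :=
  f.substInvOfIsUnit (by rw [hf]; exact isUnit_one)

/-- The quotient `t / u` for a power series `u` with `u(0) = 0` and `u'(0) = 1`: the
multiplicative inverse of the series `u / t`, whose constant term is `1`. -/
noncomputable def tDiv {κ : Type*} [CommRing κ] (u : κ⟦X⟧) : κ⟦X⟧ :=
  invOfUnit (PowerSeries.mk fun k => coeff (k + 1) u) 1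

theorem tDiv_mul_self {κ : Type*} [CommRing κ] (u : κ⟦X⟧) (h0 : constantCoeff u = 0)
    (h1 : coeff 1 u = 1) : tDiv u * u = X := by
  have hu : u = X * PowerSeries.mk fun k => coeff (k + 1) u := by
    ext (_ | k)
    · simp [h0]
    · simp [coeff_succ_X_mul]
  have hinv := invOfUnit_mul (PowerSeries.mk fun k => coeff (k + 1) u) 1 (by simp [h1])
  calc tDiv u * u = tDiv u * (X * PowerSeries.mk fun k => coeff (k + 1) u) := by rw [← hu]
    _ = X * (tDiv u * PowerSeries.mk fun k => coeff (k + 1) u) := by ring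
    _ = X := by rw [tDiv, hinv, mul_one]

/-- The series `t g / (1 - f)`, for `f(0) = 0`. -/
noncomputable def phiSeries {κ : Type*} [CommRing κ] (g f : κ⟦X⟧) : κ⟦X⟧ :=
  X * g * invOfUnit (1 - f) 1

/-- The series `t g(f̄) f̄' (t / f̄)^(n-1) / (1 - f̄)`, with `f̄` the compositional inverse of `f`. -/
noncomputable def varphiSeries {κ : Type*} [CommRing κ] (n : ℕ) (g f : κ⟦X⟧)
    (hf : coeff 1 f = 1) : κ⟦X⟧ :=
  X * g.subst (compInv f hf) * derivative κ (compInv f hf) * tDiv (compInv f hf) ^ (n - 1) *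
    invOfUnit (1 - compInv f hf) 1

/-- `φ_j`, as an element of `ZMod 2`. -/
noncomputable def phi {κ : Type*} [CommRing κ] (π : κ →+* ZMod 2) (g f : κ⟦X⟧) (j : ℕ) : ZMod 2 :=
  π (coeff j (phiSeries g f))

/-- `ϕ_j` (which depends on `n`), as an element of `ZMod 2`. -/
noncomputable def varphi {κ : Type*} [CommRing κ] (π : κ →+* ZMod 2) (n : ℕ) (g f : κ⟦X⟧)
    (hf : coeff 1 f = 1) (j : ℕ) : ZMod 2 :=
  π (coeff j (varphiSeries n g f hf))

/-- `G` has an Eulerian trail: a walk, open or closed, that uses every edge exactly once. -/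
def HasEulerianTrail {V : Type*} [DecidableEq V] (G : SimpleGraph V) : Prop :=
  ∃ (u v : V) (p : G.Walk u v), p.IsEulerian

/-- `G` is Eulerian: it has a closed Eulerian trail. -/
def IsEulerianGraph {V : Type*} [DecidableEq V] (G : SimpleGraph V) : Prop :=
  ∃ (u : V) (p : G.Walk u u), p.IsEulerian

end RiordanGraph

/-!
Modulo 2 the degree of vertex `i` is the sum of row `i` and column `i` of the Riordan array `B` of
`(t g, f)`, cut off at order `n`. The row sum is a coefficient of the geometric series
`t g (1 + f + f² + ⋯)`, since `f ^ j` has order at least `j` (`sum_coeff_mul_pow`). The column sum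
is `[t^(n-1)] t g f^i / (1 - t)`, the residue of `t g f^i / ((1 - t) t^n)`, and substituting the
compositional inverse of `f` for `t` in this residue gives the coefficient of `varphiSeries`
(`sum_coeff_mul_pow_column`). This settles the parity of the degrees (`degree_graph_eq`).

The invariance of the residue under the substitution `t ↦ u`
(`coeff_subst_mul_derivative_mul_pow`) comes down to the vanishing of the residue of
`u' / u ^ (k + 2)`. In characteristic zero that form is exact up to a nonzero integer factor. As
characteristic 2 cannot be excluded, the identity is transported from a polynomial ring over `ℤ`
(`coeff_pow_mul_derivative_X_mul`).

If the graph is proper, the diagonal entries of the lower triangular matrix of `(g, f)` are odd.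
These are the entries of `B` immediately below its diagonal, so that `1, 2, …, n` is a path and the graph is
connected (`IsProper.connected_graph`). The rest is Euler's theorem. Mathlib has the necessity of
the degree condition; sufficiency is `SimpleGraph.Connected.exists_isEulerian`: a longest trail
between the prescribed ends uses every edge, as otherwise a closed trail of unused edges could be
spliced into it.
-/

/-! ### Euler's theorem on Eulerian trails -/

namespace SimpleGraph

variable {V : Type*} {G : SimpleGraph V}

namespace Walk

variable [Fintype V] [DecidableEq V] [DecidableRel G.Adj]

theorem degree_eq_countP_edges {y : V} {l : List (Sym2 V)} (hl : l.Nodup)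
    (hG : ∀ e ∈ l, e ∈ G.edgeSet) (hy : ∀ z, G.Adj y z → s(y, z) ∈ l) :
    G.degree y = l.countP (fun e => y ∈ e) := by
  rw [← card_incidenceFinset_eq_degree, List.countP_eq_length_filter,
    ← List.toFinset_card_of_nodup (hl.filter _)]
  congr 1
  ext e
  induction e with
  | _ a b =>
    simp only [mem_incidenceFinset, List.mem_toFinset, List.mem_filter, decide_eq_true_eq,
      incidenceSet, Set.mem_sep_iff]
    refine and_congr_left fun hyab => ⟨fun h => ?_, hG _⟩
    rcases Sym2.mem_iff.1 hyab with rfl | rfl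
    · exact hy _ h
    · rw [Sym2.eq_swap]
      exact hy _ h.symm

/-- If a trail `p` leaves an even number of edges unused at every vertex, then a trail that starts
with an edge off `p` and stays off `p` can be prolonged until it closes up. -/
theorem IsTrail.exists_closed_trail_disjoint {u v x z : V} {p : G.Walk u v} (hp : p.IsTrail)
    (hdeg : ∀ y, Even (G.degree y) ↔ (u ≠ v → y ≠ u ∧ y ≠ v))
    (hxz : G.Adj x z) (hpe : s(x, z) ∉ p.edges) :
    ∃ c : G.Walk x x, c.IsTrail ∧ p.edges.Disjoint c.edges ∧ 0 < c.length := by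
  let S : Set ℕ := {k | ∃ (y : V) (c : G.Walk x y), c.IsTrail ∧ p.edges.Disjoint c.edges ∧
    c.length = k}
  have hne : 1 ∈ S := ⟨z, hxz.toWalk, by simp [isTrail_def, Adj.toWalk],
    by simpa [Adj.toWalk] using hpe, by simp [Adj.toWalk]⟩
  have hb : BddAbove S := ⟨G.edgeFinset.card, by
    rintro k ⟨y, c, hc, -, rfl⟩
    exact hc.length_le_card_edgeFinset⟩
  obtain ⟨y, c, hc, hpc, hlen⟩ := Nat.sSup_mem ⟨1, hne⟩ hb
  have hpos : 0 < c.length := by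
    rw [hlen]
    exact le_csSup hb hne
  -- a longest such trail has used up every edge at its last vertex
  have hall : ∀ w, G.Adj y w → s(y, w) ∈ p.edges ++ c.edges := by
    intro w hyw
    by_contra hmem
    rw [List.mem_append, not_or] at hmem
    have : c.length + 1 ∈ S := by
      refine ⟨w, c.concat hyw, ?_, ?_, by simp⟩
      · rw [isTrail_def, edges_concat, List.concat_eq_append, List.nodup_append']
        exact ⟨hc.edges_nodup, List.nodup_singleton _, by simpa using hmem.2⟩
      · rw [edges_concat, List.concat_eq_append, List.disjoint_append_right]
        exact ⟨hpc, by simpa using hmem.1⟩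
    have := le_csSup hb this
    omega
  have hd := degree_eq_countP_edges (hp.edges_nodup.append hc.edges_nodup hpc) (fun e he =>
    (List.mem_append.1 he).elim (fun h => p.edges_subset_edgeSet h)
      fun h => c.edges_subset_edgeSet h) hall
  have hev : Even (c.edges.countP fun e => y ∈ e) := by
    rw [List.countP_append] at hd
    have h1 := hdeg y
    rw [hd, Nat.even_add, ← hp.even_countP_edges_iff y] at h1
    tauto
  have hxy : x = y := by
    by_contra hxy
    exact ((hc.even_countP_edges_iff y).1 hev hxy).2 rfl
  subst hxy
  exact ⟨c, hc, hpc, hpos⟩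

end Walk

variable [Fintype V] [DecidableEq V] [DecidableRel G.Adj]

/-- A walk that misses an edge of a connected graph passes through a vertex at which it misses an
edge. -/
theorem Connected.exists_adj_notMem_edges (hG : G.Connected) {u v : V} (p : G.Walk u v)
    {e : Sym2 V} (he : e ∈ G.edgeSet) (hpe : e ∉ p.edges) :
    ∃ x z, x ∈ p.support ∧ G.Adj x z ∧ s(x, z) ∉ p.edges := by
  by_contra! h
  have hsupp : ∀ y, y ∈ p.support := by
    intro y
    obtain ⟨q⟩ := hG.preconnected u y
    induction q using Walk.concatRec with
    | Hnil => exact p.start_mem_support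
    | Hconcat q hadj ih =>
      exact p.snd_mem_support_of_mem_edges (h _ _ (ih p hpe h) hadj)
  induction e with
  | _ a b => exact hpe (h a b (hsupp a) he)

/-- **Euler's theorem**, the existence half: in a finite connected graph in which `u` and `v` are
the vertices of odd degree (or `u = v` and there are none), some Eulerian trail runs from `u` to
`v`. -/
theorem Connected.exists_isEulerian (hG : G.Connected) {u v : V}
    (hdeg : ∀ y, Even (G.degree y) ↔ (u ≠ v → y ≠ u ∧ y ≠ v)) :
    ∃ p : G.Walk u v, p.IsEulerian := by
  let S : Set ℕ := {k | ∃ p : G.Walk u v, p.IsTrail ∧ p.length = k}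
  have hne : S.Nonempty := by
    obtain ⟨p, hp⟩ := (hG.preconnected u v).exists_isPath
    exact ⟨_, p, hp.isTrail, rfl⟩
  have hb : BddAbove S := ⟨G.edgeFinset.card, by
    rintro k ⟨c, hc, rfl⟩
    exact hc.length_le_card_edgeFinset⟩
  obtain ⟨p, hp, hlen⟩ := Nat.sSup_mem hne hb
  refine ⟨p, hp.isEulerian_of_forall_mem fun e he => ?_⟩
  by_contra hpe
  obtain ⟨x, z, hx, hxz, hxzp⟩ := hG.exists_adj_notMem_edges p he hpe
  obtain ⟨c, hc, hpc, hpos⟩ := hp.exists_closed_trail_disjoint hdeg hxz hxzp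
  -- splicing `c` into the longest trail `p` at `x` makes it longer
  have htake := p.take_spec hx
  have hperm : ((p.takeUntil x hx).append (c.append (p.dropUntil x hx))).edges.Perm
      (p.edges ++ c.edges) := by
    conv_rhs => rw [← htake]
    simp only [Walk.edges_append, List.append_assoc]
    exact List.Perm.append_left _ List.perm_append_comm
  have hmem : p.length + c.length ∈ S := by
    refine ⟨_, (Walk.isTrail_def _).2 (hperm.nodup_iff.2
      (hp.edges_nodup.append hc.edges_nodup hpc)), ?_⟩
    rw [← Walk.length_edges, hperm.length_eq, List.length_append, Walk.length_edges,
      Walk.length_edges]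
  have := le_csSup hb hmem
  omega

end SimpleGraph

/-! ### Residues of power series under substitution -/

namespace PowerSeries

/-- Multiplied by `k + 1`, the coefficient in question is the difference of `k + 1` times the
coefficient of `X ^ (k + 1)` in `w ^ (k + 1)` and the coefficient of `X ^ k` in the derivative of
`w ^ (k + 1)`. -/
theorem coeff_pow_mul_derivative_X_mul_of_charZero {R : Type*} [CommRing R] [IsDomain R]
    [CharZero R] {v w : R⟦X⟧} (hwv : w * v = 1) (k : ℕ) :
    coeff (k + 1) (w ^ (k + 2) * derivative R (X * v)) = 0 := by
  have h0 : w * derivative R v + v * derivative R w = 0 := by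
    have := congrArg (derivative R) hwv
    rwa [Derivation.leibniz, derivative_one, smul_eq_mul, smul_eq_mul] at this
  have h1 : w ^ (k + 2) * derivative R (X * v) = w ^ (k + 1) - X * (w ^ k * derivative R w) := by
    rw [Derivation.leibniz, derivative_X, smul_eq_mul, smul_eq_mul]
    linear_combination (X * w ^ (k + 1)) * h0 + (w ^ (k + 1) - X * w ^ k * derivative R w) * hwv
  have h2 := coeff_derivative (w ^ (k + 1)) k
  rw [derivative_pow] at h2
  have h3 : ((k : R) + 1) * coeff k (w ^ k * derivative R w)
      = coeff (k + 1) (w ^ (k + 1)) * (k + 1) := by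
    rw [← h2, Nat.add_sub_cancel, mul_assoc]
    rw [show ((k + 1 : ℕ) : R⟦X⟧) = C ((k : R) + 1) by simp, coeff_C_mul]
  have h4 : (k : R) + 1 ≠ 0 := by exact_mod_cast k.succ_ne_zero
  apply mul_left_cancel₀ h4
  rw [h1, map_sub, coeff_succ_X_mul, mul_sub, h3]
  ring

theorem map_derivative {R S : Type*} [CommRing R] [CommRing S] (p : R →+* S) (F : R⟦X⟧) :
    map p (derivative R F) = derivative S (map p F) := by
  ext k
  simp [coeff_derivative]

/-- The residue of `u' / u ^ (k + 2)` vanishes, where `u = X * v` and `w` is the inverse of `v`. In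
a domain of characteristic zero this holds because the form is exact; the general case is
a specialization of a polynomial ring over `ℤ`. -/
theorem coeff_pow_mul_derivative_X_mul {R : Type*} [CommRing R] {v w : R⟦X⟧} (hwv : w * v = 1)
    (hv : constantCoeff v = 1) (k : ℕ) :
    coeff (k + 1) (w ^ (k + 2) * derivative R (X * v)) = 0 := by
  let p : MvPolynomial R ℤ →+* R := (MvPolynomial.aeval id).toRingHom
  -- a lift of `v` with indeterminates as coefficients, except for the constant term `1`
  let v' : (MvPolynomial R ℤ)⟦X⟧ := mk fun m => if m = 0 then 1 else MvPolynomial.X (coeff m v)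
  have hv' : map p v' = v := by
    ext m
    rcases m with _ | m
    · simp [v', hv]
    · simp [v', p]
  have hinv : invOfUnit v' 1 * v' = 1 := invOfUnit_mul _ _ (by
    rw [← coeff_zero_eq_constantCoeff_apply]
    simp [v'])
  have hw' : map p (invOfUnit v' 1) = w := by
    have h := congrArg (map p) hinv
    rw [map_mul, map_one, hv'] at h
    exact left_inv_eq_right_inv h (by rw [mul_comm, hwv])
  have h := congrArg p (coeff_pow_mul_derivative_X_mul_of_charZero hinv k)
  rwa [map_zero, ← coeff_map, RingHom.map_mul, RingHom.map_pow, map_derivative, RingHom.map_mul,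
    map_X, hv', hw'] at h

/-- Change of variables in a residue: the coefficient of `X ^ m` in `F` is the residue of
`F / X ^ (m + 1)`, and on the left stands the residue after the substitution `X ↦ u`, with
`w` in the role of `X / u`. -/
theorem coeff_subst_mul_derivative_mul_pow {R : Type*} [CommRing R] {u w : R⟦X⟧}
    (hu0 : constantCoeff u = 0) (hu1 : coeff 1 u = 1) (hw : w * u = X) (F : R⟦X⟧) (m : ℕ) :
    coeff m (F.subst u * derivative R u * w ^ (m + 1)) = coeff m F := by
  have hsub : HasSubst u := HasSubst.of_constantCoeff_zero' hu0
  obtain ⟨v, rfl⟩ : ∃ v, u = X * v := X_dvd_iff.2 hu0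
  have hv : constantCoeff v = 1 := by
    rw [← hu1, ← coeff_zero_eq_constantCoeff_apply]
    exact (coeff_succ_X_mul 0 v).symm
  have hwv : w * v = 1 := by
    apply X_mul_cancel
    rw [mul_one]
    linear_combination hw
  have hw0 : constantCoeff w = 1 := by
    simpa [hv] using congrArg constantCoeff hwv
  -- `F = X * H + C (F 0)`, where `H` is handled by induction and the constant by the residue lemma
  have hF (F : R⟦X⟧) : F.subst (X * v) =
      X * v * (mk fun p => coeff (p + 1) F).subst (X * v) + C (constantCoeff F) := by
    conv_lhs => rw [eq_X_mul_shift_add_const F, subst_add hsub, subst_mul hsub, subst_X hsub,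
      subst_C]
    rfl
  induction m generalizing F with
  | zero =>
    have h1 := coeff_derivative (X * v) 0
    rw [zero_add, hu1, coeff_zero_eq_constantCoeff_apply] at h1
    rw [coeff_zero_eq_constantCoeff_apply, hF]
    simp only [map_mul, map_add, h1, zero_add, pow_one, hw0]
    simp
  | succ m ih =>
    set H : R⟦X⟧ := mk fun p => coeff (p + 1) F with hH
    have hsplit : F.subst (X * v) * derivative R (X * v) * w ^ (m + 1 + 1) =
        X * (H.subst (X * v) * derivative R (X * v) * w ^ (m + 1)) +
          C (constantCoeff F) * (w ^ (m + 2) * derivative R (X * v)) := by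
      rw [hF]
      linear_combination (X * H.subst (X * v) * derivative R (X * v) * w ^ (m + 1)) * hwv
    rw [hsplit, map_add, coeff_succ_X_mul, ih, coeff_C_mul,
      coeff_pow_mul_derivative_X_mul hwv hv, mul_zero, add_zero, hH, coeff_mk]

end PowerSeries

/-! ### Degrees and connectedness of Riordan graphs -/

namespace RiordanGraph

section Coefficients

variable {κ : Type*} [CommRing κ]

theorem sum_coeff_mul_pow (g f : κ⟦X⟧) (hf0 : constantCoeff f = 0) {n i : ℕ} (hi : i < n) :
    ∑ j ∈ Finset.range n, coeff i (X * g * f ^ j) = coeff i (phiSeries g f) := by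
  have hinv : invOfUnit (1 - f) 1 * (1 - f) = 1 := invOfUnit_mul _ _ (by simp [hf0])
  have hgeom := mul_neg_geom_sum f n
  obtain ⟨q, hq⟩ : X ^ n ∣ f ^ n := pow_dvd_pow_of_dvd (X_dvd_iff.2 hf0) n
  have h : phiSeries g f = X * g * ∑ j ∈ Finset.range n, f ^ j +
      X ^ n * (q * (X * g * invOfUnit (1 - f) 1)) := by
    rw [phiSeries]
    linear_combination (X * g * ∑ j ∈ Finset.range n, f ^ j) * hinv
      - X * g * invOfUnit (1 - f) 1 * hgeom + X * g * invOfUnit (1 - f) 1 * hq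
  rw [h, map_add, coeff_X_pow_mul', if_neg (by omega), add_zero, Finset.mul_sum, map_sum]

/-- The column sums of the Riordan array of `(X * g, f)`: a partial sum of coefficients is one
coefficient after multiplication by `1 / (1 - X)`, and the substitution `X ↦ compInv f` in the
corresponding residue turns it into a coefficient of `varphiSeries`. -/
theorem sum_coeff_mul_pow_column (g f : κ⟦X⟧) (hf0 : constantCoeff f = 0) (hf1 : coeff 1 f = 1)
    {n i : ℕ} (hi : i < n) :
    ∑ k ∈ Finset.range n, coeff k (X * g * f ^ i) =
      coeff (n - 1 - i) (varphiSeries n g f hf1) := by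
  have hu0 : constantCoeff (compInv f hf1) = 0 := constantCoeff_substInvOfIsUnit ..
  have hfu : f.subst (compInv f hf1) = X := subst_substInvOfIsUnit_right _ hf0 _
  have hu1 : coeff 1 (compInv f hf1) = 1 := by
    rw [compInv, coeff_one_substInvOfIsUnit]
    have : (show IsUnit (coeff 1 f) by rw [hf1]; exact isUnit_one).unit = 1 := by
      ext
      simpa using hf1
    rw [this, inv_one, Units.val_one]
  have hw := tDiv_mul_self _ hu0 hu1
  have hsub : HasSubst (compInv f hf1) := HasSubst.of_constantCoeff_zero' hu0
  set u := compInv f hf1 with hu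
  have hgeo : (mk 1 : κ⟦X⟧).subst u = invOfUnit (1 - u) 1 := by
    have h1 := congrArg (substAlgHom hsub) (mk_one_mul_one_sub_eq_one κ)
    rw [map_mul, map_sub, map_one, coe_substAlgHom, subst_X hsub] at h1
    exact left_inv_eq_right_inv h1 (mul_invOfUnit _ _ (by simp [hu0]))
  have hsum : ∑ k ∈ Finset.range n, coeff k (X * g * f ^ i) =
      coeff (n - 1) (X * g * f ^ i * mk 1) := by
    rw [coeff_mul, Finset.Nat.sum_antidiagonal_eq_sum_range_succ_mk, Nat.succ_eq_add_one,
      Nat.sub_add_cancel (by omega)]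
    simp
  have hF : (X * g * f ^ i * mk 1).subst u * derivative κ u * tDiv u ^ (n - 1 + 1) =
      X ^ i * varphiSeries n g f hf1 := by
    rw [subst_mul hsub, subst_mul hsub, subst_mul hsub, subst_pow hsub, subst_X hsub, hfu, hgeo,
      varphiSeries, ← hu]
    linear_combination (X ^ i * g.subst u * derivative κ u * tDiv u ^ (n - 1) *
      invOfUnit (1 - u) 1) * hw
  rw [hsum, ← coeff_subst_mul_derivative_mul_pow hu0 hu1 hw, hF, coeff_X_pow_mul',
    if_pos (by omega)]

end Coefficients

variable {κ : Type*} [CommRing κ] (π : κ →+* ZMod 2)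

theorem degree_graph_eq (n : ℕ) (g f : κ⟦X⟧) (hf0 : constantCoeff f = 0) (hf1 : coeff 1 f = 1)
    (i : Fin n) :
    ((graph π n g f).degree i : ZMod 2) = phi π g f i + varphi π n g f hf1 (n - 1 - i) := by
  have hval : ∀ a : ZMod 2, (if a = 1 then (1 : ZMod 2) else 0) = a := by decide
  rw [phi, varphi, ← sum_coeff_mul_pow g f hf0 i.2, ← sum_coeff_mul_pow_column g f hf0 hf1 i.2,
    map_sum, map_sum, ← Fin.sum_univ_eq_sum_range (fun j => π (coeff i (X * g * f ^ j))),
    ← Fin.sum_univ_eq_sum_range (fun k => π (coeff k (X * g * f ^ (i : ℕ)))),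
    ← Finset.sum_add_distrib, ← SimpleGraph.card_neighborFinset_eq_degree,
    SimpleGraph.neighborFinset_eq_filter, Finset.natCast_card_filter]
  exact Finset.sum_congr rfl fun j _ => hval _

/-- Properness makes the constant term of `g` odd, so that consecutive vertices are adjacent. -/
theorem IsProper.connected_graph {n : ℕ} (hn : 1 ≤ n) {g f : κ⟦X⟧} (hf0 : constantCoeff f = 0)
    (hf1 : coeff 1 f = 1) (h : IsProper π n g f) : (graph π n g f).Connected := by
  obtain ⟨q, rfl⟩ : X ∣ f := X_dvd_iff.2 hf0
  have hcoeff : ∀ j : ℕ, coeff j (g * (X * q) ^ j) = constantCoeff g := by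
    have hq : constantCoeff q = 1 := by
      rw [← hf1, ← coeff_zero_eq_constantCoeff_apply]
      exact (coeff_succ_X_mul 0 q).symm
    intro j
    rw [mul_pow, mul_left_comm, coeff_X_pow_mul', if_pos le_rfl, Nat.sub_self]
    simp [hq]
  have hdet : (binaryRiordan π g (X * q) (n - 1)).det = π (constantCoeff g) ^ (n - 1) := by
    rw [Matrix.det_of_isLowerTriangular]
    · simp [binaryRiordan, hcoeff]
    · intro i j hij
      rw [binaryRiordan, Matrix.of_apply, mul_pow, mul_left_comm, coeff_X_pow_mul', if_neg, map_zero]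
      simpa using hij
  have hadj : ∀ (k : ℕ) (hk : k + 1 < n),
      (graph π n g (X * q)).Adj ⟨k + 1, hk⟩ ⟨k, by omega⟩ := by
    intro k hk
    have hg : π (constantCoeff g) = 1 := by
      have h1 := (Matrix.isUnit_iff_isUnit_det _).1 h
      rw [hdet, isUnit_pow_iff (by omega)] at h1
      revert h1
      generalize π (constantCoeff g) = a
      revert a
      decide
    change (binaryRiordan π (X * g) (X * q) n + (binaryRiordan π (X * g) (X * q) n).transpose)
      _ _ = 1
    rw [Matrix.add_apply, Matrix.transpose_apply, binaryRiordan, Matrix.of_apply, Matrix.of_apply]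
    rw [show coeff k (X * g * (X * q) ^ (k + 1)) = 0 by
        rw [mul_pow, mul_left_comm, coeff_X_pow_mul', if_neg (by omega)],
      mul_assoc, coeff_succ_X_mul, hcoeff, hg, map_zero, add_zero]
  have : Nonempty (Fin n) := ⟨⟨0, hn⟩⟩
  have hreach : ∀ (k : ℕ) (hk : k < n), (graph π n g (X * q)).Reachable ⟨k, hk⟩ ⟨0, hn⟩ := by
    intro k
    induction k with
    | zero => exact fun _ => SimpleGraph.Reachable.refl _
    | succ k ih => exact fun hk => (hadj k hk).reachable.trans (ih (by omega))
  exact ⟨fun i j => (hreach i i.2).trans (hreach j j.2).symm⟩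

end RiordanGraph

/-! ### Eulerian trails in Riordan graphs -/

namespace RiordanGraph

theorem _root_.SimpleGraph.Connected.hasEulerianTrail_iff {V : Type*} [Fintype V] [DecidableEq V]
    {G : SimpleGraph V} [DecidableRel G.Adj] (hG : G.Connected) :
    HasEulerianTrail G ↔ (∀ i, Even (G.degree i)) ∨ ∃ i₁ i₂, i₁ ≠ i₂ ∧ ∀ i,
      ((i = i₁ ∨ i = i₂) → Odd (G.degree i)) ∧ (¬ (i = i₁ ∨ i = i₂) → Even (G.degree i)) := by
  simp only [← Nat.not_even_iff_odd]
  constructor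
  · rintro ⟨u, v, p, hp⟩
    rcases eq_or_ne u v with huv | huv
    · exact Or.inl fun i => hp.even_degree_iff.2 fun h => absurd huv h
    · refine Or.inr ⟨u, v, huv, fun i => ?_⟩
      have := hp.even_degree_iff (x := i)
      tauto
  · rintro (h | ⟨u, v, huv, h⟩)
    · obtain ⟨u⟩ := hG.nonempty
      exact ⟨u, u, hG.exists_isEulerian fun y => by simp [h y]⟩
    · refine ⟨u, v, hG.exists_isEulerian fun y => ?_⟩
      have := h y
      tauto

end RiordanGraph

theorem mainTheorem10 {κ : Type*} [CommRing κ] (π : κ →+* ZMod 2) (n : ℕ) (hn : 1 ≤ n)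
    (g f : κ⟦X⟧) (hf0 : constantCoeff f = 0) (hf1 : coeff 1 f = 1) :
    (∀ i : Fin n,
      (Odd ((RiordanGraph.graph π n g f).degree i) ↔
        RiordanGraph.phi π g f i + RiordanGraph.varphi π n g f hf1 (n - 1 - i) = 1) ∧
      (Even ((RiordanGraph.graph π n g f).degree i) ↔
        RiordanGraph.phi π g f i + RiordanGraph.varphi π n g f hf1 (n - 1 - i) = 0)) ∧
    (RiordanGraph.IsProper π n g f →
      (RiordanGraph.HasEulerianTrail (RiordanGraph.graph π n g f) ↔
        (∀ i : Fin n,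
          RiordanGraph.phi π g f i + RiordanGraph.varphi π n g f hf1 (n - 1 - i) = 0) ∨
        (∃ i₁ i₂ : Fin n, i₁ ≠ i₂ ∧ ∀ i : Fin n,
          ((i = i₁ ∨ i = i₂) →
            RiordanGraph.phi π g f i + RiordanGraph.varphi π n g f hf1 (n - 1 - i) = 1) ∧
          (¬ (i = i₁ ∨ i = i₂) →
            RiordanGraph.phi π g f i + RiordanGraph.varphi π n g f hf1 (n - 1 - i) = 0))) ∧
      ((∀ i : Fin n,
          RiordanGraph.phi π g f i + RiordanGraph.varphi π n g f hf1 (n - 1 - i) = 0) →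
        RiordanGraph.IsEulerianGraph (RiordanGraph.graph π n g f))) := by
  have hodd (i : Fin n) : Odd ((RiordanGraph.graph π n g f).degree i) ↔
      RiordanGraph.phi π g f i + RiordanGraph.varphi π n g f hf1 (n - 1 - i) = 1 := by
    rw [← RiordanGraph.degree_graph_eq π n g f hf0 hf1 i, ZMod.natCast_eq_one_iff_odd]
  have heven (i : Fin n) : Even ((RiordanGraph.graph π n g f).degree i) ↔
      RiordanGraph.phi π g f i + RiordanGraph.varphi π n g f hf1 (n - 1 - i) = 0 := by
    rw [← RiordanGraph.degree_graph_eq π n g f hf0 hf1 i, ZMod.natCast_eq_zero_iff_even]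
  refine ⟨fun i => ⟨hodd i, heven i⟩, fun hproper => ?_⟩
  have hconn := RiordanGraph.IsProper.connected_graph π hn hf0 hf1 hproper
  simp only [← hodd, ← heven]
  exact ⟨hconn.hasEulerianTrail_iff, fun h =>
    ⟨⟨0, hn⟩, hconn.exists_isEulerian fun y => by simp [h y]⟩⟩
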